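/- Let $(M,g)$ be a smooth (Hausdorff, second countable) Riemannian manifold of dimension $n\ge 3$; no completeness or non-parabolicity is needed. Let $\mathrm{Ric}_-:M\to[0,\infty)$ be the lowest non-negative function such that $\mathrm{Ric}\ge-\mathrm{Ric}_-\,g$ as quadratic forms at every point, let $\Delta=\mathrm{tr}_g\,\mathrm{Hess}$, and set $L=-\Delta-(n-2)\mathrm{Ric}_-$. Let $\varphi\in C^2(M)$ be a solution of $L\varphi=0$ with $1\le\varphi\le\gamma$ for some constant $\gamma$, and set $f=\frac{\log\varphi}{n-2}$. Consider the conformal metric $\widetilde g=e^{2f}g$ (of class $C^2$). Then $$\varphi^{-1}\,d\mathrm{vol}_{\widetilde g}=e^{2f}\,d\mathrm{vol}_g ,$$ and the manifold $(M,\widetilde g)$ weighted with this measure has non-negative $\infty$-Bakry–Émery Ricci tensor: $$\widetilde{\mathrm{Ric}}_{\log\varphi}:=\widetilde{\mathrm{Ric}}+\widetilde{\mathrm{Hess}}(\log\varphi)\ \ge\ 0$$ as a quadratic form on every tangent space, where $\widetilde{\mathrm{Ric}}$ and $\widetilde{\mathrm{Hess}}$ are the Ricci tensor and the Hessian of $\widetilde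 g$. -/

import Mathlib

open scoped Manifold ContDiff Bundle

noncomputable section

namespace ConformalBE

/-! ### Riemannian geometry in coordinates

`G` is a field of Gram matrices `(g_ij)` on (an open subset of) Euclidean space. -/

section Coordinates

variable {n : ℕ}

/-- The partial derivative `∂_i F` at `y`. -/
def pd (i : Fin n) (F : EuclideanSpace ℝ (Fin n) → ℝ) (y : EuclideanSpace ℝ (Fin n)) : ℝ :=
  fderiv ℝ F y (EuclideanSpace.single i 1)

/-- The Christoffel symbol
`Γ^k_ij = 1/2 * ∑_l g^{kl} (∂_i g_jl + ∂_j g_il - ∂_l g_ij)` at `y`. -/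
def christoffel (G : EuclideanSpace ℝ (Fin n) → Matrix (Fin n) (Fin n) ℝ)
    (k i j : Fin n) (y : EuclideanSpace ℝ (Fin n)) : ℝ :=
  (1 / 2 : ℝ) * ∑ l, (G y)⁻¹ k l *
    (pd i (fun z => G z j l) y + pd j (fun z => G z i l) y - pd l (fun z => G z i j) y)

/-- The components of the Ricci tensor,
`R_ij = ∑_k (∂_k Γ^k_ij - ∂_j Γ^k_ik) + ∑_{k,l} (Γ^k_kl Γ^l_ij - Γ^k_jl Γ^l_ik)`
(positive on round spheres). -/
def ricciCoord (G : EuclideanSpace ℝ (Fin n) → Matrix (Fin n) (Fin n) ℝ)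
    (i j : Fin n) (y : EuclideanSpace ℝ (Fin n)) : ℝ :=
  (∑ k, (pd k (christoffel G k i j) y - pd j (christoffel G k i k) y)) +
    ∑ k, ∑ l, (christoffel G k k l y * christoffel G l i j y -
      christoffel G k j l y * christoffel G l i k y)

/-- The components of the Hessian, `(Hess u)_ij = ∂_i ∂_j u - ∑_k Γ^k_ij ∂_k u`. -/
def hessCoord (G : EuclideanSpace ℝ (Fin n) → Matrix (Fin n) (Fin n) ℝ)
    (u : EuclideanSpace ℝ (Fin n) → ℝ) (i j : Fin n) (y : EuclideanSpace ℝ (Fin n)) : ℝ :=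
  pd i (pd j u) y - ∑ k, christoffel G k i j y * pd k u y

end Coordinates

/-! ### Riemannian metrics on manifolds -/

section Manifold

variable {n : ℕ} {M : Type*} [TopologicalSpace M] [ChartedSpace (EuclideanSpace ℝ (Fin n)) M]
  [IsManifold (𝓡 n) ∞ M]

/-- Riemannian metrics of class `C^k` on the smooth `n`-dimensional manifold `M`. -/
abbrev RiemMetric (n : ℕ) (M : Type*) [TopologicalSpace M]
    [ChartedSpace (EuclideanSpace ℝ (Fin n)) M] [IsManifold (𝓡 n) ∞ M] (k : ℕ∞) :=
  Bundle.ContMDiffRiemannianMetric (𝓡 n) (k : WithTop ℕ∞) (EuclideanSpace ℝ (Fin n))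
    (fun x : M => TangentSpace (𝓡 n) x)

/-- The coordinate vector field `∂_i` of the chart around `x₀`, at the point with
coordinates `y`. -/
def coordVec (x₀ : M) (i : Fin n) (y : EuclideanSpace ℝ (Fin n)) :
    TangentSpace (𝓡 n) ((extChartAt (𝓡 n) x₀).symm y) :=
  mfderiv (𝓡 n) (𝓡 n) (extChartAt (𝓡 n) x₀).symm y
    (EuclideanSpace.single i 1 : EuclideanSpace ℝ (Fin n))

/-- The Gram matrix `g_ij = g(∂_i, ∂_j)` in the chart around `x₀`. -/
def gram {k : ℕ∞} (g : RiemMetric n M k) (x₀ : M) (y : EuclideanSpace ℝ (Fin n)) :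
    Matrix (Fin n) (Fin n) ℝ :=
  Matrix.of fun i j =>
    g.inner ((extChartAt (𝓡 n) x₀).symm y) (coordVec x₀ i y) (coordVec x₀ j y)

/-- The components of a tangent vector at `p` in the basis `∂_1, …, ∂_n` of the chart
around `p`. -/
def coord (p : M) (v : TangentSpace (𝓡 n) p) : EuclideanSpace ℝ (Fin n) :=
  mfderiv (𝓡 n) (𝓡 n) (extChartAt (𝓡 n) p) p v

/-- The Ricci tensor of `g` at `p`, computed in the chart around `p`. -/
def ricci {k : ℕ∞} (g : RiemMetric n M k) (p : M) (v w : TangentSpace (𝓡 n) p) : ℝ :=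
  ∑ i, ∑ j, ricciCoord (gram g p) i j (extChartAt (𝓡 n) p p) * coord p v i * coord p w j

/-- The Hessian of `u` with respect to `g` at `p`, computed in the chart around `p`. -/
def hess {k : ℕ∞} (g : RiemMetric n M k) (u : M → ℝ) (p : M) (v w : TangentSpace (𝓡 n) p) : ℝ :=
  ∑ i, ∑ j, hessCoord (gram g p) (fun y => u ((extChartAt (𝓡 n) p).symm y)) i j
    (extChartAt (𝓡 n) p p) * coord p v i * coord p w j

/-- The Laplace-Beltrami operator `Δ u = tr_g Hess u = ∑_{i,j} g^{ij} (Hess u)_ij`. -/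
def laplacian {k : ℕ∞} (g : RiemMetric n M k) (u : M → ℝ) (p : M) : ℝ :=
  ∑ i, ∑ j, (gram g p (extChartAt (𝓡 n) p p))⁻¹ i j *
    hessCoord (gram g p) (fun y => u ((extChartAt (𝓡 n) p).symm y)) i j (extChartAt (𝓡 n) p p)

/-- `Ric_-(p)`: the smallest `c ≥ 0` with `Ric ≥ -c g` at `p`, as quadratic forms. -/
def ricciNeg {k : ℕ∞} (g : RiemMetric n M k) (p : M) : ℝ :=
  sInf {c : ℝ | 0 ≤ c ∧ ∀ v : TangentSpace (𝓡 n) p, -c * g.inner p v v ≤ ricci g p v v}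

/-- The Schrödinger operator `L u = -Δ u - (n - 2) Ric_- u`. -/
def schrodinger {k : ℕ∞} (g : RiemMetric n M k) (u : M → ℝ) (p : M) : ℝ :=
  -laplacian g u p - ((n : ℝ) - 2) * ricciNeg g p * u p

/-- The `∞`-Bakry-Émery Ricci tensor `Ric_u = Ric + Hess u` of the metric `g` weighted by the
measure `e^{-u} dvol_g`. -/
def bakryEmeryRicci {k : ℕ∞} (g : RiemMetric n M k) (u : M → ℝ) (p : M)
    (v w : TangentSpace (𝓡 n) p) : ℝ :=
  ricci g p v w + hess g u p v w

set_option synthInstance.maxHeartbeats 400000 in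
/-- The conformal metric `e^{2f} g`. -/
def conformal {k m : ℕ∞} (hmk : m ≤ k) (g : RiemMetric n M k) (f : M → ℝ)
    (hf : ContMDiff (𝓡 n) 𝓘(ℝ) (m : WithTop ℕ∞) f) : RiemMetric n M m where
  inner p := Real.exp (2 * f p) • g.inner p
  symm p v w := by simp [g.symm p v w]
  pos p v hv := by simpa using mul_pos (Real.exp_pos _) (g.pos p v hv)
  isVonNBounded p := by
    have h := (g.isVonNBounded p).image
      (Real.exp (-f p) • ContinuousLinearMap.id ℝ (TangentSpace (𝓡 n) p))
    refine h.subset ?_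
    intro v hv
    have hv' : Real.exp (2 * f p) * g.inner p v v < 1 := by simpa using hv
    have h2 : Real.exp (2 * f p) = Real.exp (f p) * Real.exp (f p) := by
      rw [← Real.exp_add]; ring_nf
    refine ⟨Real.exp (f p) • v, ?_, ?_⟩
    · rw [h2] at hv'
      simpa [mul_assoc] using hv'
    · simp [smul_smul, ← Real.exp_add]
  contMDiff := by
    have h1 : ContMDiff (𝓡 n) 𝓘(ℝ) (m : WithTop ℕ∞) (fun p => Real.exp (2 * f p)) :=
      (Real.contDiff_exp.comp (contDiff_const.mul contDiff_id)).contMDiff.comp hf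
    have h2 := ContMDiff.of_le g.contMDiff (WithTop.coe_le_coe.2 hmk)
    exact h1.smul_section h2

variable [MeasurableSpace M]

/-- The Riemannian volume on the domain of the chart around `x₀`: the image under the inverse
chart of the measure `√(det g_ij) dy` on the target of the chart. -/
def chartVolume {k : ℕ∞} (g : RiemMetric n M k) (x₀ : M) : MeasureTheory.Measure M :=
  (((MeasureTheory.volume : MeasureTheory.Measure (EuclideanSpace ℝ (Fin n))).restrict
      (extChartAt (𝓡 n) x₀).target).withDensity
    (fun y => ENNReal.ofReal (Real.sqrt (gram g x₀ y).det))).map (extChartAt (𝓡 n) x₀).symm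

/-- The Riemannian volume measure of `g`: the smallest measure that dominates `√(det g_ij) dy` in
every chart. By the change of variables formula the chart measures agree on overlaps, so on a
second countable manifold this is the measure that equals `√(det g_ij) dy` in every chart. -/
def volumeMeasure {k : ℕ∞} (g : RiemMetric n M k) : MeasureTheory.Measure M :=
  ⨆ x₀ : M, chartVolume g x₀

end Manifold

end ConformalBE

end

/-!
Put `u = log φ = (n-2) f`. Under `g ↦ e^{2f} g` the Ricci tensor and the Hessian change by
`Ric ↦ Ric - (n-2) (Hess f - df ⊗ df) - (Δf + (n-2) |df|²) g` and
`Hess u ↦ Hess u - df ⊗ du - du ⊗ df + ⟨df, du⟩ g`. In the sum of the two the Hessian of `f`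
and the multiples `(n-2) |df|² g` cancel, and what remains is `Ric - (n-2) df ⊗ df - (Δf) g`
(`bakryEmeryCoord_conformal`, from `ricciCoord_conformal` and `hessCoord_conformal`).

Since `φ = e^{(n-2) f}`, the equation `-Δφ - (n-2) Ric_- φ = 0` says that
`Δf = -Ric_- - (n-2) |df|²` (`laplacian_of_schrodinger_exp_eq_zero`). The tensor is therefore
`(Ric + Ric_- g) + (n-2) (|df|² g - df ⊗ df)`. The first summand is non-negative because the
infimum defining `Ric_-` is attained (`ricciNeg_spec`), the second by the Cauchy–Schwarz
inequality (`sum_pd_mul_sq_le`).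

The transformation of the Ricci tensor is computed in one chart. The Christoffel symbols change by
`S^k_ij = δ^k_i ∂_j f + δ^k_j ∂_i f - g_ij f^k`. The terms quadratic in them are finite sums
(`quadratic_christoffel_conformal`); the derivatives of `S` need the compatibility of the
connection with the metric (`pd_metric`) and the identity `div grad = tr Hess` (`sum_pd_grad`).

For the volumes, `det (e^{2f} g_ij) = e^{2nf} det g_ij` shows that each chart measure is multiplied
by the density `e^{nf}`. Multiplication by a positive finite density is an order automorphism of
the measures, so it passes to the supremum over the charts (`volumeMeasure_conformal`), and
`φ⁻¹ e^{nf} = e^{2f}`.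
-/

noncomputable section

namespace ConformalBE

/-! ### Partial derivatives -/

section Calculus

variable {n : ℕ} {F H : EuclideanSpace ℝ (Fin n) → ℝ} {y : EuclideanSpace ℝ (Fin n)}

theorem pd_congr (h : F =ᶠ[nhds y] H) (i : Fin n) : pd i F y = pd i H y := by
  rw [pd, pd, h.fderiv_eq]

theorem pd_add (hF : DifferentiableAt ℝ F y) (hH : DifferentiableAt ℝ H y) (i : Fin n) :
    pd i (fun z => F z + H z) y = pd i F y + pd i H y := by
  simp [pd, fderiv_fun_add hF hH]

theorem pd_sub (hF : DifferentiableAt ℝ F y) (hH : DifferentiableAt ℝ H y) (i : Fin n) :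
    pd i (fun z => F z - H z) y = pd i F y - pd i H y := by
  simp [pd, fderiv_fun_sub hF hH]

theorem pd_mul (hF : DifferentiableAt ℝ F y) (hH : DifferentiableAt ℝ H y) (i : Fin n) :
    pd i (fun z => F z * H z) y = pd i F y * H y + F y * pd i H y := by
  simp [pd, fderiv_fun_mul hF hH]; ring

theorem pd_const_mul (hF : DifferentiableAt ℝ F y) (c : ℝ) (i : Fin n) :
    pd i (fun z => c * F z) y = c * pd i F y := by
  simp [pd, fderiv_const_mul hF]

theorem pd_sum {ι : Type*} [Fintype ι] {A : ι → EuclideanSpace ℝ (Fin n) → ℝ}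
    (hA : ∀ k, DifferentiableAt ℝ (A k) y) (i : Fin n) :
    pd i (fun z => ∑ k, A k z) y = ∑ k, pd i (A k) y := by
  simp [pd, fderiv_fun_sum (fun k _ => hA k)]

theorem pd_exp (hF : DifferentiableAt ℝ F y) (i : Fin n) :
    pd i (fun z => Real.exp (F z)) y = Real.exp (F y) * pd i F y := by
  simp [pd, fderiv_exp hF]

theorem contDiffAt_pd (hF : ContDiffAt ℝ 2 F y) (i : Fin n) : ContDiffAt ℝ 1 (pd i F) y :=
  (hF.fderiv_right (m := 1) (by norm_num)).clm_apply contDiffAt_const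

theorem differentiableAt_pd (hF : ContDiffAt ℝ 2 F y) (i : Fin n) :
    DifferentiableAt ℝ (pd i F) y :=
  (contDiffAt_pd hF i).differentiableAt one_ne_zero

theorem pd_comm (hF : ContDiffAt ℝ 2 F y) (i j : Fin n) :
    pd i (pd j F) y = pd j (pd i F) y := by
  have hd : DifferentiableAt ℝ (fderiv ℝ F) y :=
    (hF.fderiv_right (m := 1) (by norm_num)).differentiableAt one_ne_zero
  have hs := hF.isSymmSndFDerivAt (by simp)
  have key : ∀ a b : Fin n, pd a (pd b F) y =
      fderiv ℝ (fderiv ℝ F) y (EuclideanSpace.single a 1) (EuclideanSpace.single b 1) := by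
    intro a b
    have h := fderiv_clm_apply hd
      (differentiableAt_const (x := y) (EuclideanSpace.single b (1 : ℝ)))
    unfold pd
    rw [h]
    simp
  rw [key, key]
  exact hs _ _

theorem contDiffAt_det {m : ℕ} {k : WithTop ℕ∞}
    {A : EuclideanSpace ℝ (Fin n) → Matrix (Fin m) (Fin m) ℝ}
    (hA : ∀ i j, ContDiffAt ℝ k (fun z => A z i j) y) :
    ContDiffAt ℝ k (fun z => (A z).det) y := by
  simp only [Matrix.det_apply']
  exact ContDiffAt.sum fun σ _ => contDiffAt_const.mul (contDiffAt_prod fun i _ => hA _ _)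

theorem contDiffAt_inv_apply {m : ℕ} {k : WithTop ℕ∞}
    {A : EuclideanSpace ℝ (Fin n) → Matrix (Fin m) (Fin m) ℝ}
    (hA : ∀ i j, ContDiffAt ℝ k (fun z => A z i j) y) (hdet : (A y).det ≠ 0) (i j : Fin m) :
    ContDiffAt ℝ k (fun z => (A z)⁻¹ i j) y := by
  simp only [Matrix.inv_def, Matrix.smul_apply, Ring.inverse_eq_inv', smul_eq_mul,
    Matrix.adjugate_apply]
  refine ((contDiffAt_det hA).inv hdet).mul (contDiffAt_det fun a b => ?_)
  by_cases hab : a = j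
  · subst hab
    simpa using contDiffAt_const
  · simpa [Matrix.updateRow_ne hab] using hA a b

end Calculus

/-! ### The Levi-Civita connection in coordinates -/

section Metric

variable {n : ℕ} {G : EuclideanSpace ℝ (Fin n) → Matrix (Fin n) (Fin n) ℝ}
  {F u : EuclideanSpace ℝ (Fin n) → ℝ} {y : EuclideanSpace ℝ (Fin n)}

theorem sum_mul_inv (hdet : (G y).det ≠ 0) (a b : Fin n) :
    ∑ l, G y a l * (G y)⁻¹ l b = if a = b then 1 else 0 := by
  rw [← Matrix.mul_apply, Matrix.mul_nonsing_inv _ (isUnit_iff_ne_zero.2 hdet), Matrix.one_apply]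

theorem christoffel_symm (hG : ∀ z i j, G z i j = G z j i) (k i j : Fin n) :
    christoffel G k i j y = christoffel G k j i y := by
  unfold christoffel
  congr 1
  refine Finset.sum_congr rfl fun l _ => ?_
  rw [show (fun z => G z j i) = fun z => G z i j from funext fun z => hG z j i]
  ring

theorem contDiffAt_christoffel (hGd : ∀ i j, ContDiffAt ℝ 2 (fun z => G z i j) y)
    (hdet : (G y).det ≠ 0) (k i j : Fin n) : ContDiffAt ℝ 1 (christoffel G k i j) y := by
  unfold christoffel
  refine contDiffAt_const.mul (ContDiffAt.sum fun l _ => ?_)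
  exact ((contDiffAt_inv_apply hGd hdet k l).of_le (by norm_num)).mul
    (((contDiffAt_pd (hGd j l) i).add (contDiffAt_pd (hGd i l) j)).sub (contDiffAt_pd (hGd i j) l))

/-- The Christoffel symbols with lowered index. -/
theorem sum_mul_christoffel (hdet : (G y).det ≠ 0) (a i j : Fin n) :
    ∑ k, G y a k * christoffel G k i j y = (1 / 2 : ℝ) *
      (pd i (fun z => G z j a) y + pd j (fun z => G z i a) y - pd a (fun z => G z i j) y) := by
  unfold christoffel
  have : ∀ k, G y a k * ((1 / 2 : ℝ) * ∑ l, (G y)⁻¹ k l *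
      (pd i (fun z => G z j l) y + pd j (fun z => G z i l) y - pd l (fun z => G z i j) y)) =
      ∑ l, (G y a k * (G y)⁻¹ k l) * ((1 / 2 : ℝ) *
      (pd i (fun z => G z j l) y + pd j (fun z => G z i l) y - pd l (fun z => G z i j) y)) := by
    intro k
    rw [Finset.mul_sum, Finset.mul_sum]
    exact Finset.sum_congr rfl fun l _ => by ring
  simp_rw [this]
  rw [Finset.sum_comm]
  simp_rw [← Finset.sum_mul, sum_mul_inv hdet]
  simp

/-- The Levi-Civita connection is compatible with the metric:
`∂_k g_ij = ∑_l (Γ^l_ki g_jl + Γ^l_kj g_il)`. -/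
theorem pd_metric (hG : ∀ z i j, G z i j = G z j i) (hdet : (G y).det ≠ 0) (k i j : Fin n) :
    pd k (fun z => G z i j) y =
      (∑ l, G y j l * christoffel G l k i y) + ∑ l, G y i l * christoffel G l k j y := by
  rw [sum_mul_christoffel hdet, sum_mul_christoffel hdet,
    show (fun z => G z j i) = fun z => G z i j from funext fun z => hG z j i]
  ring

/-- The components `F^k = ∑_l g^{kl} ∂_l F` of the gradient of `F`. -/
def grad (G : EuclideanSpace ℝ (Fin n) → Matrix (Fin n) (Fin n) ℝ)
    (F : EuclideanSpace ℝ (Fin n) → ℝ) (k : Fin n) (y : EuclideanSpace ℝ (Fin n)) : ℝ :=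
  ∑ l, (G y)⁻¹ k l * pd l F y

/-- Lowering the index of the gradient gives back the differential. -/
theorem sum_mul_grad (hdet : (G y).det ≠ 0) (i : Fin n) :
    ∑ k, G y i k * grad G F k y = pd i F y := by
  unfold grad
  simp_rw [Finset.mul_sum, ← mul_assoc]
  rw [Finset.sum_comm]
  simp_rw [← Finset.sum_mul, sum_mul_inv hdet]
  simp

theorem differentiableAt_grad (hGd : ∀ i j, ContDiffAt ℝ 2 (fun z => G z i j) y)
    (hdet : (G y).det ≠ 0) (hF : ContDiffAt ℝ 2 F y) (k : Fin n) :
    DifferentiableAt ℝ (grad G F k) y := by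
  unfold grad
  exact DifferentiableAt.fun_sum fun l _ =>
    ((contDiffAt_inv_apply hGd hdet k l).differentiableAt two_ne_zero).mul
      (differentiableAt_pd hF l)

theorem eventually_det_ne_zero (hGd : ∀ i j, ContDiffAt ℝ 2 (fun z => G z i j) y)
    (hdet : (G y).det ≠ 0) : ∀ᶠ z in nhds y, (G z).det ≠ 0 :=
  (contDiffAt_det hGd).continuousAt.eventually_ne hdet

/-- The derivative of `∂_i F = ∑_k g_ik F^k`. The relation is differentiated as an identity of
functions near `y`, so that no derivative of a matrix inverse appears. -/
theorem sum_pd_mul_grad (hGd : ∀ i j, ContDiffAt ℝ 2 (fun z => G z i j) y)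
    (hdet : (G y).det ≠ 0) (hF : ContDiffAt ℝ 2 F y) (i j : Fin n) :
    ∑ k, pd j (fun z => G z i k * grad G F k z) y = pd j (pd i F) y := by
  rw [← pd_sum fun k => ((hGd i k).differentiableAt two_ne_zero).fun_mul
    (differentiableAt_grad hGd hdet hF k)]
  refine pd_congr ?_ j
  filter_upwards [eventually_det_ne_zero hGd hdet] with z hz using sum_mul_grad hz i

/-- The divergence of the gradient is the trace of the Hessian:
`∑_k ∂_k F^k + ∑_{k,l} Γ^k_kl F^l = ∑_{i,j} g^{ij} (Hess F)_ij`. -/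
theorem sum_pd_grad (hG : ∀ z i j, G z i j = G z j i)
    (hGd : ∀ i j, ContDiffAt ℝ 2 (fun z => G z i j) y)
    (hdet : (G y).det ≠ 0) (hF : ContDiffAt ℝ 2 F y) :
    ∑ k, pd k (grad G F k) y = (∑ a, ∑ b, (G y)⁻¹ a b * hessCoord G F a b y) -
      ∑ k, ∑ l, christoffel G k k l y * grad G F l y := by
  -- The gradient is characterized by `∑_k g_bk F^k = ∂_b F`; differentiating this relation
  -- avoids derivatives of the inverse matrix.
  have h1 : ∀ a b, pd a (pd b F) y =
      (∑ k, pd a (fun z => G z b k) y * grad G F k y) + ∑ k, G y b k * pd a (grad G F k) y := by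
    intro a b
    rw [← sum_pd_mul_grad hGd hdet hF b a, ← Finset.sum_add_distrib]
    exact Finset.sum_congr rfl fun k _ => pd_mul ((hGd b k).differentiableAt two_ne_zero)
      (differentiableAt_grad hGd hdet hF k) a
  have h2 : ∀ a b, ∑ k, pd a (fun z => G z b k) y * grad G F k y =
      (∑ l, christoffel G l a b y * pd l F y) +
        ∑ k, ∑ l, G y b l * christoffel G l a k y * grad G F k y := by
    intro a b
    simp_rw [pd_metric hG hdet, add_mul, Finset.sum_add_distrib, Finset.sum_mul]
    congr 1
    rw [Finset.sum_comm]
    refine Finset.sum_congr rfl fun l _ => ?_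
    rw [← sum_mul_grad (F := F) hdet l, Finset.mul_sum]
    refine Finset.sum_congr rfl fun k _ => ?_
    rw [hG y k l]; ring
  have h3 : ∀ a b, hessCoord G F a b y =
      (∑ k, ∑ l, G y b l * christoffel G l a k y * grad G F k y) +
        ∑ k, G y b k * pd a (grad G F k) y := by
    intro a b
    rw [hessCoord, h1, h2]; ring
  have h4 : ∀ X : Fin n → Fin n → ℝ, ∑ a, ∑ b, (G y)⁻¹ a b * ∑ k, G y b k * X a k =
      ∑ a, X a a := by
    intro X
    refine Finset.sum_congr rfl fun a _ => ?_
    simp_rw [Finset.mul_sum, ← mul_assoc]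
    rw [Finset.sum_comm]
    simp_rw [← Finset.sum_mul, ← Matrix.mul_apply,
      Matrix.nonsing_inv_mul _ (isUnit_iff_ne_zero.2 hdet), Matrix.one_apply]
    simp
  have h5 : ∀ a b, ∑ k, ∑ l, G y b l * christoffel G l a k y * grad G F k y =
      ∑ l, G y b l * ∑ k, christoffel G l a k y * grad G F k y := by
    intro a b
    rw [Finset.sum_comm]
    simp_rw [Finset.mul_sum, mul_assoc]
  simp_rw [h3, mul_add, Finset.sum_add_distrib, h5]
  rw [h4 fun a l => ∑ k, christoffel G l a k y * grad G F k y,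
    h4 fun a k => pd a (grad G F k) y]
  ring

/-! ### Conformal change of the metric in coordinates -/

/-- The Christoffel symbols of `e^{2F} g`:
`Γ^k_ij + δ^k_i ∂_j F + δ^k_j ∂_i F - g_ij F^k`. -/
theorem christoffel_conformal (hG : ∀ z i j, G z i j = G z j i)
    (hGd : ∀ i j, DifferentiableAt ℝ (fun z => G z i j) y)
    (hdet : (G y).det ≠ 0) (hF : DifferentiableAt ℝ F y) (k i j : Fin n) :
    christoffel (fun z => Real.exp (2 * F z) • G z) k i j y =
      christoffel G k i j y + ((if k = i then 1 else 0) * pd j F y +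
        (if k = j then 1 else 0) * pd i F y - G y i j * grad G F k y) := by
  have hp : ∀ a b c, pd a (fun z => (Real.exp (2 * F z) • G z) b c) y =
      Real.exp (2 * F y) * (2 * pd a F y * G y b c + pd a (fun z => G z b c) y) := by
    intro a b c
    simp only [Matrix.smul_apply, smul_eq_mul]
    rw [pd_mul (by fun_prop) (hGd b c), pd_exp (by fun_prop), pd_const_mul hF]
    ring
  have hinv : (Real.exp (2 * F y) • G y)⁻¹ = (Real.exp (2 * F y))⁻¹ • (G y)⁻¹ := by
    refine Matrix.inv_eq_left_inv ?_
    rw [Matrix.smul_mul, Matrix.mul_smul, smul_smul, inv_mul_cancel₀ (Real.exp_ne_zero _), one_smul,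
      Matrix.nonsing_inv_mul _ (isUnit_iff_ne_zero.2 hdet)]
  have hl : ∀ b, ∑ l, (G y)⁻¹ k l * G y b l = if k = b then 1 else 0 := by
    intro b
    simp_rw [hG y b, ← Matrix.mul_apply, Matrix.nonsing_inv_mul _ (isUnit_iff_ne_zero.2 hdet),
      Matrix.one_apply]
  have he := Real.exp_ne_zero (2 * F y)
  unfold christoffel
  simp_rw [hp, hinv, Matrix.smul_apply, smul_eq_mul]
  rw [← hl i, ← hl j, grad]
  simp_rw [Finset.mul_sum, Finset.sum_mul, ← Finset.sum_add_distrib, ← Finset.sum_sub_distrib,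
    ← Finset.sum_add_distrib]
  refine Finset.sum_congr rfl fun l _ => ?_
  field_simp
  ring

/-- The Hessian for `e^{2F} g`: `Hess u - dF ⊗ du - du ⊗ dF + ⟨dF, du⟩ g`. -/
theorem hessCoord_conformal (hG : ∀ z i j, G z i j = G z j i)
    (hGd : ∀ i j, DifferentiableAt ℝ (fun z => G z i j) y)
    (hdet : (G y).det ≠ 0) (hF : DifferentiableAt ℝ F y) (i j : Fin n) :
    hessCoord (fun z => Real.exp (2 * F z) • G z) u i j y =
      hessCoord G u i j y - pd i F y * pd j u y - pd j F y * pd i u y +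
        G y i j * ∑ k, grad G F k y * pd k u y := by
  unfold hessCoord
  simp only [christoffel_conformal hG hGd hdet hF, sub_mul, add_mul, Finset.sum_add_distrib,
    Finset.sum_sub_distrib, Finset.mul_sum, ite_mul, one_mul, zero_mul, Finset.sum_ite_eq',
    Finset.mem_univ, if_true, mul_assoc]
  ring

end Metric

section ConformalRicci

variable {n : ℕ} {G : EuclideanSpace ℝ (Fin n) → Matrix (Fin n) (Fin n) ℝ}
  {F u : EuclideanSpace ℝ (Fin n) → ℝ} {y : EuclideanSpace ℝ (Fin n)}

/-- The quadratic part of the Ricci tensor after the conformal change `Γ ↦ Γ + S`,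
`S^k_ij = δ^k_i f_j + δ^k_j f_i - g_ij U^k`, of the Christoffel symbols. -/
theorem quadratic_christoffel_conformal (Γ S : Fin n → Fin n → Fin n → ℝ)
    (g : Fin n → Fin n → ℝ) (f U : Fin n → ℝ) (hΓ : ∀ k i j, Γ k i j = Γ k j i)
    (hg : ∀ i j, g i j = g j i) (hf : ∀ i, ∑ k, g i k * U k = f i)
    (hS : ∀ k i j, S k i j = (if k = i then 1 else 0) * f j + (if k = j then 1 else 0) * f i -
      g i j * U k) (i j : Fin n) :
    ∑ k, ∑ l, ((Γ k k l + S k k l) * (Γ l i j + S l i j) -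
        (Γ k j l + S k j l) * (Γ l i k + S l i k)) =
      (∑ k, ∑ l, (Γ k k l * Γ l i j - Γ k j l * Γ l i k)) -
        g i j * (∑ k, ∑ l, Γ k k l * U l) + ((n : ℝ) - 2) * (∑ l, Γ l i j * f l) +
        (∑ k, ∑ l, g j l * Γ l k i * U k) + (∑ k, ∑ l, g i l * Γ l k j * U k) +
        ((n : ℝ) - 2) * (f i * f j) - ((n : ℝ) - 2) * (g i j * ∑ k, U k * f k) := by
  have hf' : ∀ i, ∑ k, g k i * U k = f i := fun i => by simp_rw [fun k => hg k i, hf]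
  have htr : ∀ l, ∑ k, S k k l = n * f l := by
    intro l
    simp only [hS, Finset.sum_sub_distrib, Finset.sum_add_distrib, hf']
    simp
  have e1 : ∑ k, ∑ l, Γ k k l * S l i j = (∑ k, Γ k k i) * f j + (∑ k, Γ k k j) * f i -
      g i j * ∑ k, ∑ l, Γ k k l * U l := by
    simp only [hS, mul_add, mul_sub, Finset.sum_add_distrib, Finset.sum_sub_distrib,
      Finset.mul_sum, Finset.sum_mul, ite_mul, mul_ite, one_mul, zero_mul, mul_zero,
      Finset.sum_ite_eq', Finset.mem_univ, if_true, mul_left_comm]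
  have e2 : ∀ X : Fin n → ℝ, ∑ k, ∑ l, S k k l * X l = n * ∑ l, X l * f l := by
    intro X
    rw [Finset.sum_comm, Finset.mul_sum]
    refine Finset.sum_congr rfl fun l _ => ?_
    rw [← Finset.sum_mul, htr]; ring
  have e3 : ∑ l, S l i j * f l = 2 * (f i * f j) - g i j * ∑ k, U k * f k := by
    simp only [hS, add_mul, sub_mul, Finset.sum_add_distrib, Finset.sum_sub_distrib,
      Finset.mul_sum, ite_mul, one_mul, zero_mul,
      Finset.sum_ite_eq', Finset.mem_univ, if_true, mul_assoc]
    ring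
  have e4 : ∑ k, ∑ l, Γ k j l * S l i k = (∑ l, Γ l i j * f l) + (∑ k, Γ k k j) * f i -
      ∑ k, ∑ l, g i l * Γ l k j * U k := by
    simp only [hS, mul_add, mul_sub, Finset.sum_add_distrib, Finset.sum_sub_distrib,
      Finset.sum_mul, ite_mul, mul_ite, one_mul, zero_mul, mul_zero,
      Finset.sum_ite_eq', Finset.mem_univ, if_true]
    congr 1
    · simp_rw [hΓ _ j]
    · rw [Finset.sum_comm]
      refine Finset.sum_congr rfl fun l _ => Finset.sum_congr rfl fun k _ => ?_
      rw [hΓ k l j]; ring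
  have e5 : ∑ k, ∑ l, S k j l * Γ l i k = (∑ l, Γ l i j * f l) + (∑ k, Γ k k i) * f j -
      ∑ k, ∑ l, g j l * Γ l k i * U k := by
    simp only [hS, add_mul, sub_mul, Finset.sum_add_distrib, Finset.sum_sub_distrib,
      Finset.sum_mul, ite_mul, one_mul, zero_mul]
    congr 1
    · congr 1
      · rw [Finset.sum_comm]
        simp [mul_comm]
      · simp [mul_comm, hΓ _ i]
    · refine Finset.sum_congr rfl fun l _ => Finset.sum_congr rfl fun k _ => ?_
      rw [hΓ k i l]; ring
  have e6 : ∑ k, ∑ l, S k j l * S l i k = ((n : ℝ) + 2) * (f i * f j) -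
      2 * (g i j * ∑ k, U k * f k) := by
    have : ∀ k, ∑ l, S k j l * S l i k = (if k = j then 1 else 0) * ∑ l, S l i k * f l +
        f j * S k i k - U k * ∑ l, g j l * S l i k := by
      intro k
      simp only [hS k j, add_mul, sub_mul, Finset.sum_add_distrib, Finset.sum_sub_distrib,
        Finset.mul_sum]
      congr 1
      · congr 1
        · refine Finset.sum_congr rfl fun l _ => by ring
        · simp
      · refine Finset.sum_congr rfl fun l _ => by ring
    have h2 : ∀ k, ∑ l, g j l * S l i k = g i j * f k + g j k * f i - g i k * f j := by
      intro k
      simp only [hS, mul_add, mul_sub, Finset.sum_add_distrib, Finset.sum_sub_distrib]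
      simp only [ite_mul, mul_ite, one_mul, zero_mul, mul_zero, Finset.sum_ite_eq',
        Finset.mem_univ, if_true, mul_left_comm _ (g i k), ← Finset.mul_sum, hf, hg j i]
    have hS' : ∀ k, S k i k = S k k i := fun k => by rw [hS, hS, hg i k]; ring
    have h3 : ∑ k, U k * (g i j * f k + g j k * f i - g i k * f j) =
        g i j * ∑ k, U k * f k := by
      have : ∀ k, U k * (g i j * f k + g j k * f i - g i k * f j) =
          g i j * (U k * f k) + (g j k * U k) * f i - (g i k * U k) * f j := fun k => by ring
      simp_rw [this, Finset.sum_sub_distrib, Finset.sum_add_distrib, ← Finset.sum_mul,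
        ← Finset.mul_sum, hf]
      ring
    simp_rw [this, h2, Finset.sum_sub_distrib, Finset.sum_add_distrib, h3, hS',
      ← Finset.mul_sum, htr]
    simp only [ite_mul, one_mul, zero_mul, Finset.sum_ite_eq', Finset.mem_univ, if_true, e3]
    ring
  have hsplit : ∀ k l, (Γ k k l + S k k l) * (Γ l i j + S l i j) -
        (Γ k j l + S k j l) * (Γ l i k + S l i k) =
      (Γ k k l * Γ l i j - Γ k j l * Γ l i k) + Γ k k l * S l i j + S k k l * Γ l i j +
        S k k l * S l i j - Γ k j l * S l i k - S k j l * Γ l i k - S k j l * S l i k :=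
    fun k l => by ring
  simp_rw [hsplit]
  simp only [Finset.sum_sub_distrib, Finset.sum_add_distrib]
  rw [e1, e2 (fun l => Γ l i j), e2 (fun l => S l i j), e3, e4, e5, e6]
  ring

/-- The Ricci tensor of `e^{2F} g`:
`Ric - (n-2) (Hess F - dF ⊗ dF) - (ΔF + (n-2) |dF|²) g`. -/
theorem ricciCoord_conformal (hG : ∀ z i j, G z i j = G z j i)
    (hGd : ∀ i j, ContDiffAt ℝ 2 (fun z => G z i j) y)
    (hdet : (G y).det ≠ 0) (hF : ContDiffAt ℝ 2 F y) (i j : Fin n) :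
    ricciCoord (fun z => Real.exp (2 * F z) • G z) i j y =
      ricciCoord G i j y - ((n : ℝ) - 2) * (hessCoord G F i j y - pd i F y * pd j F y) -
        G y i j * ((∑ a, ∑ b, (G y)⁻¹ a b * hessCoord G F a b y) +
          ((n : ℝ) - 2) * ∑ k, grad G F k y * pd k F y) := by
  have hGd1 : ∀ i j, DifferentiableAt ℝ (fun z => G z i j) y :=
    fun i j => (hGd i j).differentiableAt two_ne_zero
  have hF1 : DifferentiableAt ℝ F y := hF.differentiableAt two_ne_zero
  have hU := differentiableAt_grad hGd hdet hF
  have hΓ : ∀ k i j, DifferentiableAt ℝ (christoffel G k i j) y := fun k i j =>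
    (contDiffAt_christoffel hGd hdet k i j).differentiableAt one_ne_zero
  have hev : ∀ k i j, christoffel (fun z => Real.exp (2 * F z) • G z) k i j =ᶠ[nhds y]
      fun z => christoffel G k i j z + ((if k = i then 1 else 0) * pd j F z +
        (if k = j then 1 else 0) * pd i F z - G z i j * grad G F k z) := by
    intro k i j
    have hG' : ∀ᶠ z in nhds y, ∀ a b, DifferentiableAt ℝ (fun z => G z a b) z :=
      Filter.eventually_all.2 fun a => Filter.eventually_all.2 fun b =>
        ((hGd a b).eventually (by simp)).mono fun z hz => hz.differentiableAt two_ne_zero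
    filter_upwards [eventually_det_ne_zero hGd hdet, hG', hF.eventually (by simp)] with z h1 h2 h3
    exact christoffel_conformal hG h2 h1 (h3.differentiableAt two_ne_zero) k i j
  have hpd : ∀ m k i j, pd m (christoffel (fun z => Real.exp (2 * F z) • G z) k i j) y =
      pd m (christoffel G k i j) y + ((if k = i then 1 else 0) * pd m (pd j F) y +
        (if k = j then 1 else 0) * pd m (pd i F) y -
        pd m (fun z => G z i j * grad G F k z) y) := by
    intro m k i j
    have d1 := differentiableAt_pd hF
    have d2 := ((hGd1 i j).fun_mul (hU k))
    rw [pd_congr (hev k i j), pd_add (hΓ k i j) ((((d1 j).const_mul _).fun_add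
      ((d1 i).const_mul _)).fun_sub d2), pd_sub (((d1 j).const_mul _).fun_add
      ((d1 i).const_mul _)) d2, pd_add ((d1 j).const_mul _) ((d1 i).const_mul _),
      pd_const_mul (d1 j), pd_const_mul (d1 i)]
  -- The trace `∑_k S^k_ik` is `n ∂_i F`, because `∑_k g_ik F^k = ∂_i F`.
  have hA : ∑ k, (pd k (christoffel (fun z => Real.exp (2 * F z) • G z) k i j) y -
        pd j (christoffel (fun z => Real.exp (2 * F z) • G z) k i k) y) =
      (∑ k, (pd k (christoffel G k i j) y - pd j (christoffel G k i k) y)) +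
        ((2 - (n : ℝ)) * pd i (pd j F) y - ∑ k, pd k (fun z => G z i j * grad G F k z) y) := by
    simp_rw [hpd]
    simp only [Finset.sum_sub_distrib, Finset.sum_add_distrib, sum_pd_mul_grad hGd hdet hF]
    simp [pd_comm hF j i]
    ring
  have hdiv : ∑ k, pd k (fun z => G z i j * grad G F k z) y =
      (∑ k, ∑ l, G y j l * christoffel G l k i y * grad G F k y) +
      (∑ k, ∑ l, G y i l * christoffel G l k j y * grad G F k y) +
      G y i j * ∑ k, pd k (grad G F k) y := by
    simp_rw [pd_mul (hGd1 i j) (hU _), pd_metric hG hdet, add_mul, Finset.sum_mul,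
      Finset.sum_add_distrib, Finset.mul_sum]
  have hB := quadratic_christoffel_conformal (fun k i j => christoffel G k i j y)
    (fun k i j => (if k = i then 1 else 0) * pd j F y +
        (if k = j then 1 else 0) * pd i F y - G y i j * grad G F k y) (G y)
    (fun k => pd k F y) (fun k => grad G F k y) (christoffel_symm hG) (hG y)
    (sum_mul_grad hdet) (fun _ _ _ => rfl) i j
  have hC := christoffel_conformal hG hGd1 hdet hF1
  have hB' : ∑ k, ∑ l, (christoffel (fun z => Real.exp (2 * F z) • G z) k k l y *
        christoffel (fun z => Real.exp (2 * F z) • G z) l i j y -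
        christoffel (fun z => Real.exp (2 * F z) • G z) k j l y *
        christoffel (fun z => Real.exp (2 * F z) • G z) l i k y) = _ :=
    (Finset.sum_congr rfl fun k _ => Finset.sum_congr rfl fun l _ => by
      rw [hC k k l, hC l i j, hC k j l, hC l i k]).trans hB
  rw [ricciCoord, hA, hdiv, sum_pd_grad hG hGd hdet hF, hB', ricciCoord]
  simp only [hessCoord]
  ring

/-- The Hessian of `F` in terms of the one of `e^{cF}`. -/
theorem hessCoord_exp (hF : ContDiffAt ℝ 2 F y) (c : ℝ) (i j : Fin n) :
    hessCoord G (fun z => Real.exp (c * F z)) i j y =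
      Real.exp (c * F y) * (c * hessCoord G F i j y + c ^ 2 * (pd i F y * pd j F y)) := by
  have hp : ∀ k, pd k (fun z => Real.exp (c * F z)) =ᶠ[nhds y]
      fun z => Real.exp (c * F z) * (c * pd k F z) := by
    intro k
    filter_upwards [hF.eventually (by simp)] with z hz
    have hz1 := hz.differentiableAt two_ne_zero
    rw [pd_exp (hz1.const_mul c), pd_const_mul hz1]
  have hF1 : DifferentiableAt ℝ F y := hF.differentiableAt two_ne_zero
  have hpd := differentiableAt_pd hF
  unfold hessCoord
  simp_rw [(hp _).eq_of_nhds]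
  rw [pd_congr (hp j), pd_mul (hF1.const_mul c).exp ((hpd j).const_mul c), (hp i).eq_of_nhds,
    pd_const_mul (hpd j), mul_add, mul_sub, Finset.mul_sum, mul_sub, Finset.mul_sum]
  have : ∀ k, christoffel G k i j y * (Real.exp (c * F y) * (c * pd k F y)) =
    Real.exp (c * F y) * (c * (christoffel G k i j y * pd k F y)) := fun k => by ring
  simp_rw [this]
  ring

theorem hessCoord_const_mul (hF : ContDiffAt ℝ 2 F y) (c : ℝ) (i j : Fin n) :
    hessCoord G (fun z => c * F z) i j y = c * hessCoord G F i j y := by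
  have hp : ∀ k, pd k (fun z => c * F z) =ᶠ[nhds y] fun z => c * pd k F z := by
    intro k
    filter_upwards [hF.eventually (by simp)] with z hz
    rw [pd_const_mul (hz.differentiableAt two_ne_zero)]
  unfold hessCoord
  simp_rw [(hp _).eq_of_nhds]
  rw [pd_congr (hp j), pd_const_mul (differentiableAt_pd hF j), mul_sub, Finset.mul_sum]
  simp_rw [mul_left_comm]

/-- The `∞`-Bakry–Émery Ricci tensor of `e^{2F} g` with potential `(n-2) F` is
`Ric - (n-2) dF ⊗ dF - (ΔF) g`: the Hessians of `F` cancel. -/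
theorem bakryEmeryCoord_conformal (hG : ∀ z i j, G z i j = G z j i)
    (hGd : ∀ i j, ContDiffAt ℝ 2 (fun z => G z i j) y)
    (hdet : (G y).det ≠ 0) (hF : ContDiffAt ℝ 2 F y) (i j : Fin n) :
    ricciCoord (fun z => Real.exp (2 * F z) • G z) i j y +
      hessCoord (fun z => Real.exp (2 * F z) • G z) (fun z => ((n : ℝ) - 2) * F z) i j y =
    ricciCoord G i j y - ((n : ℝ) - 2) * (pd i F y * pd j F y) -
      G y i j * ∑ a, ∑ b, (G y)⁻¹ a b * hessCoord G F a b y := by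
  have hF1 : DifferentiableAt ℝ F y := hF.differentiableAt two_ne_zero
  rw [ricciCoord_conformal hG hGd hdet hF, hessCoord_conformal hG
    (fun i j => (hGd i j).differentiableAt two_ne_zero) hdet hF1, hessCoord_const_mul hF]
  simp_rw [pd_const_mul hF1]
  have : ∀ k, grad G F k y * (((n : ℝ) - 2) * pd k F y) =
    ((n : ℝ) - 2) * (grad G F k y * pd k F y) := fun k => by ring
  simp_rw [this, ← Finset.mul_sum]
  ring

end ConformalRicci

/-! ### Gram matrices of Riemannian metrics -/

section Gram

variable {n : ℕ} {M : Type*} [TopologicalSpace M] [ChartedSpace (EuclideanSpace ℝ (Fin n)) M]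
  [IsManifold (𝓡 n) ∞ M] {k : ℕ∞} (g : RiemMetric n M k)

theorem gram_symm (x₀ : M) (y : EuclideanSpace ℝ (Fin n)) (i j : Fin n) :
    gram g x₀ y i j = gram g x₀ y j i :=
  g.symm _ _ _

theorem gram_conformal {m : ℕ∞} (hmk : m ≤ k) (f : M → ℝ)
    (hf : ContMDiff (𝓡 n) 𝓘(ℝ) (m : WithTop ℕ∞) f) (x₀ : M) (y : EuclideanSpace ℝ (Fin n)) :
    gram (conformal hmk g f hf) x₀ y =
      Real.exp (2 * f ((extChartAt (𝓡 n) x₀).symm y)) • gram g x₀ y :=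
  rfl

/-- The coordinate vector fields are smooth: they are the images of the constant vector fields under
the tangent map of the inverse chart. -/
theorem contMDiffOn_coordVec (x₀ : M) (i : Fin n) :
    ContMDiffOn 𝓘(ℝ, EuclideanSpace ℝ (Fin n)) (𝓡 n).tangent ∞
      (fun y => (⟨(extChartAt (𝓡 n) x₀).symm y, coordVec x₀ i y⟩ : TangentBundle (𝓡 n) M))
      (extChartAt (𝓡 n) x₀).target := by
  have hopen := isOpen_extChartAt_target (I := 𝓡 n) x₀
  have h := (contMDiffOn_extChartAt_symm (I := 𝓡 n) (n := ∞) x₀).contMDiffOn_tangentMapWithin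
    (m := ∞) le_rfl hopen.uniqueMDiffOn
  have hs : ContMDiff 𝓘(ℝ, EuclideanSpace ℝ (Fin n)) 𝓘(ℝ, EuclideanSpace ℝ (Fin n)).tangent ∞
      (fun y => (⟨y, EuclideanSpace.single i (1 : ℝ)⟩ :
        TangentBundle 𝓘(ℝ, EuclideanSpace ℝ (Fin n)) (EuclideanSpace ℝ (Fin n)))) := fun y =>
    contMDiffAt_vectorSpace_iff_contDiffAt.2 contDiffAt_const
  refine (h.comp (hs.contMDiffOn (s := (extChartAt (𝓡 n) x₀).target)) fun y hy => hy).congr ?_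
  intro y hy
  simp only [Function.comp_apply, tangentMapWithin, coordVec]
  rw [mfderivWithin_of_isOpen hopen hy]

theorem contDiffOn_gram (x₀ : M) (i j : Fin n) :
    ContDiffOn ℝ k (fun y => gram g x₀ y i j) (extChartAt (𝓡 n) x₀).target := by
  rw [← contMDiffOn_iff_contDiffOn]
  have hk : (k : WithTop ℕ∞) ≤ ∞ := WithTop.coe_le_coe.2 le_top
  have hψ := g.contMDiff.comp_contMDiffOn
    ((contMDiffOn_extChartAt_symm (I := 𝓡 n) (n := ∞) x₀).of_le hk)
  have h := ContMDiffOn.clm_bundle_apply₂ (F₃ := ℝ) (E₃ := Bundle.Trivial M ℝ) hψ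
    ((contMDiffOn_coordVec x₀ i).of_le hk) ((contMDiffOn_coordVec x₀ j).of_le hk)
  intro y hy
  have := h y hy
  simp only [Bundle.contMDiffWithinAt_totalSpace] at this
  exact this.2

/-- The inner product on `T_p M`, viewed as a bilinear form on the model space, to which `T_p M`
is definitionally equal. -/
def innerModel (p : M) : LinearMap.BilinForm ℝ (EuclideanSpace ℝ (Fin n)) :=
  ContinuousLinearMap.toLinearMap₁₂
    (g.inner p : EuclideanSpace ℝ (Fin n) →L[ℝ] EuclideanSpace ℝ (Fin n) →L[ℝ] ℝ)

/-- At its center, the preferred chart induces the identity of the tangent space, which is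
definitionally the model space. -/
theorem coord_self (p : M) (v : TangentSpace (𝓡 n) p) :
    coord p v = (v : EuclideanSpace ℝ (Fin n)) := by
  rw [coord, mfderiv_extChartAt_self]; rfl

theorem coordVec_self (p : M) (i : Fin n) :
    (coordVec p i (extChartAt (𝓡 n) p p) : EuclideanSpace ℝ (Fin n)) =
      EuclideanSpace.single i (1 : ℝ) := by
  have h := mfderivWithin_range_extChartAt_symm (I := 𝓡 n) (x := p)
  rw [ModelWithCorners.range_eq_univ, mfderivWithin_univ] at h
  exact congrArg (fun L : EuclideanSpace ℝ (Fin n) →L[ℝ] EuclideanSpace ℝ (Fin n) =>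
    L (EuclideanSpace.single i 1)) h

theorem gram_self (p : M) (i j : Fin n) :
    gram g p (extChartAt (𝓡 n) p p) i j =
      innerModel g p (EuclideanSpace.single i 1) (EuclideanSpace.single j 1) := by
  have h : ∀ q, q = p → ∀ v w : EuclideanSpace ℝ (Fin n),
      (g.inner q : EuclideanSpace ℝ (Fin n) →L[ℝ] EuclideanSpace ℝ (Fin n) →L[ℝ] ℝ) v w =
        innerModel g p v w := by
    rintro q rfl v w; rfl
  rw [← coordVec_self p i, ← coordVec_self p j]
  exact h _ (extChartAt_to_inv p) _ _

theorem innerModel_eq_sum (p : M) (v w : EuclideanSpace ℝ (Fin n)) :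
    innerModel g p v w = ∑ i, ∑ j, gram g p (extChartAt (𝓡 n) p p) i j * v i * w j := by
  have hv : ∀ v : EuclideanSpace ℝ (Fin n), v = ∑ i, v i • EuclideanSpace.single i (1 : ℝ) := by
    intro v
    simpa using ((EuclideanSpace.basisFun (Fin n) ℝ).sum_repr v).symm
  conv_lhs => rw [hv v, hv w]
  simp only [map_sum, LinearMap.sum_apply, map_smul, LinearMap.smul_apply, smul_eq_mul, gram_self]
  simp_rw [Finset.mul_sum]
  rw [Finset.sum_comm]
  exact Finset.sum_congr rfl fun i _ => Finset.sum_congr rfl fun j _ => by ring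

theorem innerModel_pos (p : M) {v : EuclideanSpace ℝ (Fin n)} (hv : v ≠ 0) :
    0 < innerModel g p v v :=
  g.pos p v hv

theorem innerModel_nonneg (p : M) (v : EuclideanSpace ℝ (Fin n)) : 0 ≤ innerModel g p v v := by
  rcases eq_or_ne v 0 with rfl | hv
  · simp
  · exact (innerModel_pos g p hv).le

theorem innerModel_sq_le (p : M) (v w : EuclideanSpace ℝ (Fin n)) :
    innerModel g p v w ^ 2 ≤ innerModel g p v v * innerModel g p w w :=
  LinearMap.BilinForm.apply_sq_le_of_symm _ (innerModel_nonneg g p) ⟨fun v w => g.symm p v w⟩ v w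

theorem det_gram_self_ne_zero (p : M) : (gram g p (extChartAt (𝓡 n) p p)).det ≠ 0 := by
  intro h
  obtain ⟨v, hv, hv'⟩ := Matrix.exists_mulVec_eq_zero_iff.2 h
  have hpos := innerModel_pos g p (v := WithLp.toLp 2 v) (by simpa using hv)
  rw [innerModel_eq_sum] at hpos
  have : ∀ i, ∑ j, gram g p (extChartAt (𝓡 n) p p) i j * v i * v j = 0 := by
    intro i
    have := congrFun hv' i
    simp only [Matrix.mulVec, dotProduct, Pi.zero_apply] at this
    rw [← mul_zero (v i), ← this, Finset.mul_sum]
    exact Finset.sum_congr rfl fun j _ => by ring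
  exact hpos.ne' (Finset.sum_eq_zero fun i _ => this i)

/-- The inner product dominates the Euclidean norm of the model space. -/
theorem exists_norm_sq_le (p : M) : ∃ C : ℝ, 0 ≤ C ∧ ∀ v : EuclideanSpace ℝ (Fin n),
    ‖v‖ ^ 2 ≤ C * innerModel g p v v := by
  have hb : Bornology.IsBounded {v : EuclideanSpace ℝ (Fin n) | innerModel g p v v < 1} :=
    (NormedSpace.isVonNBounded_iff ℝ).1 (g.isVonNBounded p)
  obtain ⟨r, hr⟩ := hb.exists_norm_le
  refine ⟨2 * r ^ 2, by positivity, fun v => ?_⟩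
  rcases eq_or_ne v 0 with rfl | hv
  · simp
  have hB := innerModel_pos g p hv
  set b := innerModel g p v v
  -- The multiple `t v` with `g(t v, t v) = 1/2` lies in the bounded set.
  set t := Real.sqrt (1 / (2 * b))
  have ht : t ^ 2 = 1 / (2 * b) := Real.sq_sqrt (by positivity)
  have h1 : ‖t • v‖ ≤ r := by
    refine hr _ ?_
    have : innerModel g p (t • v) (t • v) = t ^ 2 * b := by
      simp only [map_smul, LinearMap.smul_apply, smul_eq_mul, b]; ring
    rw [Set.mem_ofPred_eq, this, ht]
    field_simp
    norm_num
  have h2 : ‖t • v‖ ^ 2 ≤ r ^ 2 := pow_le_pow_left₀ (norm_nonneg _) h1 2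
  rw [norm_smul, mul_pow, Real.norm_eq_abs, sq_abs, ht] at h2
  field_simp at h2
  linarith

end Gram

/-! ### The lowest Ricci curvature -/

section RicciNeg

variable {n : ℕ} {M : Type*} [TopologicalSpace M] [ChartedSpace (EuclideanSpace ℝ (Fin n)) M]
  [IsManifold (𝓡 n) ∞ M] {k : ℕ∞} (g : RiemMetric n M k)

/-- The set whose infimum is `Ric_-` is non-empty, so that the infimum is not a junk value. -/
theorem exists_ricci_lower_bound (p : M) :
    ∃ c : ℝ, 0 ≤ c ∧ ∀ v : TangentSpace (𝓡 n) p, -c * g.inner p v v ≤ ricci g p v v := by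
  obtain ⟨C, hC0, hC⟩ := exists_norm_sq_le g p
  set R := fun i j => ricciCoord (gram g p) i j (extChartAt (𝓡 n) p p)
  refine ⟨(∑ i, ∑ j, |R i j|) * C, by positivity, fun v => ?_⟩
  have hv : -((∑ i, ∑ j, |R i j|) * ‖coord p v‖ ^ 2) ≤ ricci g p v v := by
    rw [ricci, Finset.sum_mul, ← Finset.sum_neg_distrib]
    refine Finset.sum_le_sum fun i _ => ?_
    rw [Finset.sum_mul, ← Finset.sum_neg_distrib]
    refine Finset.sum_le_sum fun j _ => ?_
    have hi := PiLp.norm_apply_le (coord p v) i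
    have hj := PiLp.norm_apply_le (coord p v) j
    refine neg_le_of_abs_le ?_
    rw [mul_assoc, abs_mul, abs_mul, sq]
    exact mul_le_mul_of_nonneg_left (mul_le_mul hi hj (abs_nonneg _) (norm_nonneg _))
      (abs_nonneg _)
  have h2 := hC (coord p v)
  have h3 : innerModel g p (coord p v) (coord p v) = g.inner p v v := by rw [coord_self]; rfl
  rw [h3] at h2
  have h4 : 0 ≤ ∑ i, ∑ j, |R i j| := by positivity
  nlinarith [mul_le_mul_of_nonneg_left h2 h4]

/-- The infimum that defines `Ric_-` is attained. -/
theorem ricciNeg_spec (p : M) : 0 ≤ ricciNeg g p ∧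
    ∀ v : TangentSpace (𝓡 n) p, -ricciNeg g p * g.inner p v v ≤ ricci g p v v := by
  refine IsClosed.csInf_mem (s := {c : ℝ | 0 ≤ c ∧ ∀ v : TangentSpace (𝓡 n) p,
    -c * g.inner p v v ≤ ricci g p v v}) ?_ (exists_ricci_lower_bound g p) ⟨0, fun c hc => hc.1⟩
  simp only [Set.ofPred_and, Set.ofPred_forall]
  exact (isClosed_le continuous_const continuous_id).inter
    (isClosed_iInter fun v => isClosed_le (by fun_prop) continuous_const)

end RicciNeg

/-! ### Non-negativity of the Bakry–Émery Ricci tensor -/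

section Positivity

variable {n : ℕ} {M : Type*} [TopologicalSpace M] [ChartedSpace (EuclideanSpace ℝ (Fin n)) M]
  [IsManifold (𝓡 n) ∞ M] (g : RiemMetric n M (⊤ : ℕ∞))

theorem contDiffAt_comp_extChartAt_symm {f : M → ℝ} (hf : ContMDiff (𝓡 n) 𝓘(ℝ) 2 f) (p : M) :
    ContDiffAt ℝ 2 (fun y => f ((extChartAt (𝓡 n) p).symm y)) (extChartAt (𝓡 n) p p) := by
  rw [← contMDiffAt_iff_contDiffAt]
  have h := hf.comp_contMDiffOn ((contMDiffOn_extChartAt_symm (I := 𝓡 n) (n := ∞) p).of_le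
    (WithTop.coe_le_coe.2 (le_top : (2 : ℕ∞) ≤ ⊤)))
  exact h.contMDiffAt (extChartAt_target_mem_nhds p)

theorem contDiffAt_gram (p : M) (i j : Fin n) :
    ContDiffAt ℝ 2 (fun y => gram g p y i j) (extChartAt (𝓡 n) p p) :=
  ((contDiffOn_gram g p i j).contDiffAt (extChartAt_target_mem_nhds p)).of_le
    (WithTop.coe_le_coe.2 (le_top : (2 : ℕ∞) ≤ ⊤))

/-- If `e^{(n-2) f}` solves the Schrödinger equation `-Δ - (n-2) Ric_- = 0`, then
`Δ f = -Ric_- - (n-2) |df|²`. -/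
theorem laplacian_of_schrodinger_exp_eq_zero (hn : 3 ≤ n) {φ f : M → ℝ}
    (hf : ContMDiff (𝓡 n) 𝓘(ℝ) 2 f) (hφ : ∀ p, φ p = Real.exp (((n : ℝ) - 2) * f p)) {p : M}
    (hL : schrodinger g φ p = 0) :
    laplacian g f p = -ricciNeg g p - ((n : ℝ) - 2) *
      ∑ k, grad (gram g p) (fun y => f ((extChartAt (𝓡 n) p).symm y)) k (extChartAt (𝓡 n) p p) *
        pd k (fun y => f ((extChartAt (𝓡 n) p).symm y)) (extChartAt (𝓡 n) p p) := by
  have hn' : (0 : ℝ) < (n : ℝ) - 2 := by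
    have : (3 : ℝ) ≤ n := mod_cast hn
    linarith
  have hF := contDiffAt_comp_extChartAt_symm hf p
  set F := fun y => f ((extChartAt (𝓡 n) p).symm y) with hFdef
  have hFy : F (extChartAt (𝓡 n) p p) = f p := by rw [hFdef]; simp
  have hlap : laplacian g φ p = φ p * (((n : ℝ) - 2) * laplacian g f p +
      ((n : ℝ) - 2) ^ 2 * ∑ k, grad (gram g p) F k (extChartAt (𝓡 n) p p) *
        pd k F (extChartAt (𝓡 n) p p)) := by
    have hφF : (fun y => φ ((extChartAt (𝓡 n) p).symm y)) =
        fun y => Real.exp (((n : ℝ) - 2) * F y) := funext fun y => hφ _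
    rw [laplacian, laplacian, hφF, hφ]
    simp_rw [hessCoord_exp hF, grad, Finset.mul_sum, Finset.sum_mul, ← Finset.sum_add_distrib,
      Finset.mul_sum, ← Finset.sum_add_distrib, Finset.mul_sum]
    refine Finset.sum_congr rfl fun a _ => Finset.sum_congr rfl fun b _ => ?_
    rw [← hFy]
    ring
  have hφ0 : 0 < φ p := by rw [hφ]; exact Real.exp_pos _
  rw [schrodinger, hlap] at hL
  have : φ p * ((n : ℝ) - 2) * (laplacian g f p + ((n : ℝ) - 2) *
      (∑ k, grad (gram g p) F k (extChartAt (𝓡 n) p p) * pd k F (extChartAt (𝓡 n) p p)) +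
        ricciNeg g p) = 0 := by
    linear_combination -hL
  have h := (mul_eq_zero.1 this).resolve_left (by positivity)
  linarith

/-- `(df v)² ≤ |df|² g(v, v)`. -/
theorem sum_pd_mul_sq_le (F : EuclideanSpace ℝ (Fin n) → ℝ) (p : M)
    (v : EuclideanSpace ℝ (Fin n)) :
    (∑ i, pd i F (extChartAt (𝓡 n) p p) * v i) ^ 2 ≤
      (∑ k, grad (gram g p) F k (extChartAt (𝓡 n) p p) * pd k F (extChartAt (𝓡 n) p p)) *
        innerModel g p v v := by
  have hU := sum_mul_grad (F := F) (det_gram_self_ne_zero g p)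
  set y₀ := extChartAt (𝓡 n) p p
  -- Cauchy–Schwarz is applied to the gradient `U`, for which `g(U, w) = dF w`.
  set U : EuclideanSpace ℝ (Fin n) := WithLp.toLp 2 fun k => grad (gram g p) F k y₀ with hUdef
  have h1 : ∀ w : EuclideanSpace ℝ (Fin n), innerModel g p U w = ∑ i, pd i F y₀ * w i := by
    intro w
    rw [innerModel_eq_sum, Finset.sum_comm]
    refine Finset.sum_congr rfl fun i _ => ?_
    rw [← hU i, Finset.sum_mul]
    refine Finset.sum_congr rfl fun k _ => ?_
    rw [gram_symm]
  have h2 := innerModel_sq_le g p U v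
  rw [h1, h1] at h2
  refine h2.trans_eq ?_
  congr 1
  exact Finset.sum_congr rfl fun k _ => mul_comm _ _

/-- The `∞`-Bakry–Émery Ricci tensor of `e^{2f} g` with potential `(n-2) f` is
`Ric - (n-2) df ⊗ df - (Δf) g`. -/
theorem bakryEmeryRicci_conformal {f : M → ℝ}
    (hf : ContMDiff (𝓡 n) 𝓘(ℝ) ((2 : ℕ∞) : WithTop ℕ∞) f) {u : M → ℝ}
    (hu : ∀ p, u p = ((n : ℝ) - 2) * f p) (p : M) (v : TangentSpace (𝓡 n) p) :
    bakryEmeryRicci (conformal le_top g f hf) u p v v = ricci g p v v -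
      ((n : ℝ) - 2) * (∑ i, pd i (fun y => f ((extChartAt (𝓡 n) p).symm y))
        (extChartAt (𝓡 n) p p) * coord p v i) ^ 2 - laplacian g f p * g.inner p v v := by
  have hF := contDiffAt_comp_extChartAt_symm hf p
  have hinner : g.inner p v v = innerModel g p (coord p v) (coord p v) := by rw [coord_self]; rfl
  have hG : gram (conformal le_top g f hf) p = fun y =>
    Real.exp (2 * f ((extChartAt (𝓡 n) p).symm y)) • gram g p y := rfl
  have huF : (fun y => u ((extChartAt (𝓡 n) p).symm y)) =
    fun y => ((n : ℝ) - 2) * f ((extChartAt (𝓡 n) p).symm y) := funext fun y => hu _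
  have key := bakryEmeryCoord_conformal (gram_symm g p) (contDiffAt_gram g p)
    (det_gram_self_ne_zero g p) hF
  rw [bakryEmeryRicci, ricci, hess, hinner, innerModel_eq_sum, hG, huF, ← Finset.sum_add_distrib,
    laplacian, ricci]
  set F := fun y => f ((extChartAt (𝓡 n) p).symm y)
  set y₀ := extChartAt (𝓡 n) p p
  set T := ∑ a, ∑ b, (gram g p y₀)⁻¹ a b * hessCoord (gram g p) F a b y₀
  have hterm : ∀ i j, ricciCoord (fun z => Real.exp (2 * F z) • gram g p z) i j y₀ *
        coord p v i * coord p v j +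
      hessCoord (fun z => Real.exp (2 * F z) • gram g p z) (fun z => ((n : ℝ) - 2) * F z) i j y₀ *
        coord p v i * coord p v j =
      ricciCoord (gram g p) i j y₀ * coord p v i * coord p v j -
        ((n : ℝ) - 2) * ((pd i F y₀ * coord p v i) * (pd j F y₀ * coord p v j)) -
        T * (gram g p y₀ i j * coord p v i * coord p v j) := by
    intro i j
    linear_combination (coord p v i * coord p v j) * key i j
  rw [sq, Finset.sum_mul_sum, Finset.mul_sum, Finset.mul_sum, ← Finset.sum_sub_distrib,
    ← Finset.sum_sub_distrib]
  refine Finset.sum_congr rfl fun i _ => ?_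
  rw [Finset.mul_sum, Finset.mul_sum, ← Finset.sum_sub_distrib, ← Finset.sum_sub_distrib,
    ← Finset.sum_add_distrib]
  exact Finset.sum_congr rfl fun j _ => hterm i j

theorem bakryEmeryRicci_conformal_nonneg (hn : 3 ≤ n) {φ f : M → ℝ}
    (hf : ContMDiff (𝓡 n) 𝓘(ℝ) ((2 : ℕ∞) : WithTop ℕ∞) f)
    (hφ : ∀ p, φ p = Real.exp (((n : ℝ) - 2) * f p)) (hL : ∀ p, schrodinger g φ p = 0)
    (p : M) (v : TangentSpace (𝓡 n) p) :
    0 ≤ bakryEmeryRicci (conformal le_top g f hf) (fun q => Real.log (φ q)) p v v := by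
  have hn' : (0 : ℝ) < (n : ℝ) - 2 := by
    have : (3 : ℝ) ≤ n := mod_cast hn
    linarith
  rw [bakryEmeryRicci_conformal g hf (fun q => by rw [hφ, Real.log_exp]),
    laplacian_of_schrodinger_exp_eq_zero g hn hf hφ (hL p)]
  have h1 := (ricciNeg_spec g p).2 v
  have h2 := sum_pd_mul_sq_le g (fun y => f ((extChartAt (𝓡 n) p).symm y)) p (coord p v)
  have hinner : innerModel g p (coord p v) (coord p v) = g.inner p v v := by rw [coord_self]; rfl
  rw [hinner] at h2
  linarith [mul_le_mul_of_nonneg_left h2 hn'.le]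

end Positivity

/-! ### Volume measures -/

section Measure

open MeasureTheory

variable {α β : Type*} [MeasurableSpace α] [MeasurableSpace β]

theorem withDensity_mono_left {μ ν : Measure α} (h : μ ≤ ν) (ρ : α → ENNReal) :
    μ.withDensity ρ ≤ ν.withDensity ρ := by
  refine Measure.le_iff.2 fun s hs => ?_
  rw [withDensity_apply _ hs, withDensity_apply _ hs]
  exact lintegral_mono' (Measure.restrict_mono le_rfl h) le_rfl

/-- Multiplication by a positive finite density is an order automorphism of the lattice of
measures, so it commutes with suprema. -/
theorem withDensity_iSup {ι : Sort*} (μ : ι → Measure α) {ρ : α → ENNReal} (hρ : Measurable ρ)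
    (h0 : ∀ x, ρ x ≠ 0) (htop : ∀ x, ρ x ≠ ⊤) :
    (⨆ i, μ i).withDensity ρ = ⨆ i, (μ i).withDensity ρ := by
  have hinv : ∀ μ : Measure α, (μ.withDensity ρ).withDensity ρ⁻¹ = μ := fun μ =>
    withDensity_inv_same hρ (ae_of_all _ h0) (ae_of_all _ htop)
  let e : Measure α ≃o Measure α :=
    { toFun := fun μ => μ.withDensity ρ
      invFun := fun μ => μ.withDensity ρ⁻¹
      left_inv := hinv
      right_inv := fun μ => by
        have h := withDensity_inv_same (μ := μ) hρ.inv
          (ae_of_all _ fun x => ENNReal.inv_ne_zero.2 (htop x))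
          (ae_of_all _ fun x => ENNReal.inv_ne_top.2 (h0 x))
        simpa only [Pi.inv_apply, inv_inv] using h
      map_rel_iff' := by
        intro μ ν
        refine ⟨fun h => ?_, fun h => withDensity_mono_left h ρ⟩
        rw [← hinv μ, ← hinv ν]
        exact withDensity_mono_left h ρ⁻¹ }
  exact e.map_iSup μ

theorem map_withDensity_comp {μ : Measure α} {F : α → β} (hF : AEMeasurable F μ)
    {ρ : β → ENNReal} (hρ : Measurable ρ) :
    (μ.withDensity (fun x => ρ (F x))).map F = (μ.map F).withDensity ρ := by
  have hac := withDensity_absolutelyContinuous μ fun x => ρ (F x)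
  ext s hs
  rw [Measure.map_apply_of_aemeasurable (hF.mono_ac hac) hs, withDensity_apply _ hs,
    Measure.restrict_map_of_aemeasurable hF hs,
    lintegral_map' hρ.aemeasurable (hF.mono_measure Measure.restrict_le_self),
    withDensity_apply₀ _ (hF.nullMeasurableSet_preimage hs)]

end Measure

section Volume

open MeasureTheory

variable {n : ℕ} {M : Type*} [TopologicalSpace M] [ChartedSpace (EuclideanSpace ℝ (Fin n)) M]
  [IsManifold (𝓡 n) ∞ M] [MeasurableSpace M] [BorelSpace M] (g : RiemMetric n M (⊤ : ℕ∞))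

theorem chartVolume_conformal {m : ℕ∞} {f : M → ℝ}
    (hf : ContMDiff (𝓡 n) 𝓘(ℝ) (m : WithTop ℕ∞) f) (x₀ : M) :
    chartVolume (conformal le_top g f hf) x₀ =
      (chartVolume g x₀).withDensity fun q => ENNReal.ofReal (Real.exp (n * f q)) := by
  have hT : MeasurableSet (extChartAt (𝓡 n) x₀).target :=
    (isOpen_extChartAt_target x₀).measurableSet
  have hsymm : AEMeasurable (extChartAt (𝓡 n) x₀).symm
      ((volume : Measure (EuclideanSpace ℝ (Fin n))).restrict (extChartAt (𝓡 n) x₀).target) :=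
    (continuousOn_extChartAt_symm x₀).aemeasurable hT
  have hdet : ContinuousOn (fun y => (gram g x₀ y).det) (extChartAt (𝓡 n) x₀).target := by
    simp only [Matrix.det_apply']
    exact continuousOn_finsetSum _ fun σ _ => continuousOn_const.mul
      (continuousOn_finsetProd _ fun i _ => (contDiffOn_gram g x₀ _ _).continuousOn)
  have hρ : Measurable fun q => ENNReal.ofReal (Real.exp (n * f q)) :=
    (Real.continuous_exp.comp (continuous_const.mul hf.continuous)).measurable.ennreal_ofReal
  have h1 : AEMeasurable (fun y => ENNReal.ofReal (Real.sqrt (gram g x₀ y).det))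
      ((volume : Measure (EuclideanSpace ℝ (Fin n))).restrict (extChartAt (𝓡 n) x₀).target) :=
    ((Real.continuous_sqrt.comp_continuousOn hdet).aemeasurable hT).ennreal_ofReal
  rw [chartVolume, chartVolume, ← map_withDensity_comp
    (hsymm.mono_ac (withDensity_absolutelyContinuous _ _)) hρ]
  have hmul := withDensity_mul₀ h1 (hρ.comp_aemeasurable hsymm)
  simp only [Function.comp_def] at hmul
  rw [← hmul]
  congr 2
  funext y
  have he : Real.exp (2 * f ((extChartAt (𝓡 n) x₀).symm y)) ^ n =
      Real.exp (n * f ((extChartAt (𝓡 n) x₀).symm y)) ^ 2 := by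
    rw [← Real.exp_nat_mul, ← Real.exp_nat_mul]
    congr 1
    push_cast
    ring
  rw [gram_conformal, Matrix.det_smul, Fintype.card_fin, he, Real.sqrt_mul (sq_nonneg _),
    Real.sqrt_sq (Real.exp_pos _).le, mul_comm, ENNReal.ofReal_mul (Real.sqrt_nonneg _)]
  rfl

/-- The volume measure of `e^{2f} g` is `e^{nf} dvol_g`. -/
theorem volumeMeasure_conformal {m : ℕ∞} {f : M → ℝ}
    (hf : ContMDiff (𝓡 n) 𝓘(ℝ) (m : WithTop ℕ∞) f) :
    volumeMeasure (conformal le_top g f hf) =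
      (volumeMeasure g).withDensity fun q => ENNReal.ofReal (Real.exp (n * f q)) := by
  have hρ : Measurable fun q => ENNReal.ofReal (Real.exp (n * f q)) :=
    (Real.continuous_exp.comp (continuous_const.mul hf.continuous)).measurable.ennreal_ofReal
  rw [volumeMeasure, volumeMeasure, withDensity_iSup _ hρ
    (fun q => (ENNReal.ofReal_pos.2 (Real.exp_pos _)).ne') fun q => ENNReal.ofReal_ne_top]
  exact iSup_congr fun x₀ => chartVolume_conformal g hf x₀

end Volume

end ConformalBE

end

theorem mainTheorem6 {n : ℕ} (hn : 3 ≤ n)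
    {M : Type*} [TopologicalSpace M] [T2Space M] [SecondCountableTopology M]
    [ChartedSpace (EuclideanSpace ℝ (Fin n)) M] [IsManifold (𝓡 n) ∞ M]
    [MeasurableSpace M] [BorelSpace M]
    (g : ConformalBE.RiemMetric n M (⊤ : ℕ∞)) (γ : ℝ) (φ f : M → ℝ)
    (hφ : ContMDiff (𝓡 n) 𝓘(ℝ) 2 φ)
    (hLφ : ∀ p, ConformalBE.schrodinger g φ p = 0)
    (hφγ : ∀ p, 1 ≤ φ p ∧ φ p ≤ γ)
    (hf : ∀ p, f p = Real.log (φ p) / ((n : ℝ) - 2)) :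
    ∃ hf₂ : ContMDiff (𝓡 n) 𝓘(ℝ) ((2 : ℕ∞) : WithTop ℕ∞) f,
      (∀ (p : M) (v : TangentSpace (𝓡 n) p),
        0 ≤ ConformalBE.bakryEmeryRicci (ConformalBE.conformal le_top g f hf₂)
          (fun q => Real.log (φ q)) p v v) ∧
      (ConformalBE.volumeMeasure (ConformalBE.conformal le_top g f hf₂)).withDensity
          (fun q => ENNReal.ofReal (φ q)⁻¹) =
        (ConformalBE.volumeMeasure g).withDensity (fun q => ENNReal.ofReal (Real.exp (2 * f q))) := by
  have hn' : (n : ℝ) - 2 ≠ 0 := by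
    have : (3 : ℝ) ≤ n := mod_cast hn
    linarith
  have hφ0 : ∀ p, 0 < φ p := fun p => zero_lt_one.trans_le (hφγ p).1
  have hf₂ : ContMDiff (𝓡 n) 𝓘(ℝ) ((2 : ℕ∞) : WithTop ℕ∞) f := by
    rw [show f = fun p => Real.log (φ p) / ((n : ℝ) - 2) from funext hf]
    intro p
    exact ContDiffAt.comp_contMDiffAt
      (g := fun t => Real.log t / ((n : ℝ) - 2))
      ((Real.contDiffAt_log.2 (hφ0 p).ne').div_const _) (hφ p)
  have hφf : ∀ p, φ p = Real.exp (((n : ℝ) - 2) * f p) := fun p => by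
    rw [hf, mul_div_cancel₀ _ hn', Real.exp_log (hφ0 p)]
  refine ⟨hf₂, ConformalBE.bakryEmeryRicci_conformal_nonneg g hn hf₂ hφf hLφ, ?_⟩
  have h1 : Measurable fun q => ENNReal.ofReal (Real.exp (n * f q)) :=
    (Real.continuous_exp.comp (continuous_const.mul hf₂.continuous)).measurable.ennreal_ofReal
  have h2 : Measurable fun q => ENNReal.ofReal (φ q)⁻¹ :=
    hφ.continuous.measurable.inv.ennreal_ofReal
  rw [ConformalBE.volumeMeasure_conformal, ← MeasureTheory.withDensity_mul _ h1 h2]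
  congr 1
  funext q
  rw [Pi.mul_apply, ← ENNReal.ofReal_mul (Real.exp_pos _).le, hφf, ← Real.exp_neg, ← Real.exp_add]
  congr 2
  ring
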